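/- Let $U$ be a universal (optimal) prefix-free machine, i.e. a partial computable function from finite binary strings to finite binary strings with prefix-free domain such that for every prefix-free machine $M$ there is a constant $d$ such that every $M$-program of any string $x$ can be replaced by a $U$-program of $x$ that is at most $d$ bits longer. Let $K(x)=\min\{|p| : U(p)=x\}$ denote the corresponding prefix-free complexity, and for $A\subseteq\mathbb N$ let $A\restriction_n$ be the string of the first $n$ bits of the characteristic sequence of $A$. Let $h:\mathbb N\to\mathbb N$ be a computable non-decreasing function. Then the following are equivalent: (a) for every computably enumerable set $A\subseteq\mathbb N$ there is a constant $c$ such that $K(A\restriction_n)\le h(n)+\log_2 n+c$ for all $n\ge 1$; (b) $\sum_n 2^{-h(n)}<\infty$. -/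

import Mathlib

/-- A (Turing) machine from binary strings to binary strings is a partial function; it is a
prefix-free machine if it is partial computable and no program in its domain is a proper prefix
of another program in its domain. -/
structure IsPrefixFreeMachine (M : List Bool →. List Bool) : Prop where
  partrec : Partrec M
  prefixFree : ∀ p q : List Bool, (M p).Dom → (M q).Dom → p <+: q → p = q

/-- A universal (optimal) prefix-free machine: it simulates every prefix-free machine, with
descriptions longer by at most an additive constant. -/
structure IsUniversalPrefixFreeMachine (U : List Bool →. List Bool) : Prop
    extends IsPrefixFreeMachine U where
  universal : ∀ M : List Bool →. List Bool, IsPrefixFreeMachine M →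
    ∃ c : ℕ, ∀ p x : List Bool, x ∈ M p → ∃ q : List Bool, x ∈ U q ∧ q.length ≤ p.length + c

/-- Prefix-free Kolmogorov complexity of the string `x` with respect to `U`: the least length of
a program `p` with `U p = x`. The set is nonempty if `U` is a universal prefix-free machine, see
`IsUniversalPrefixFreeMachine.exists_program`. -/
noncomputable def prefixFreeComplexity (U : List Bool →. List Bool) (x : List Bool) : ℕ :=
  sInf {l : ℕ | ∃ p : List Bool, x ∈ U p ∧ p.length = l}

open Classical in
/-- The first `n` bits `A(0) A(1) … A(n-1)` of the characteristic sequence of `A`. -/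
noncomputable def initialSegment (A : Set ℕ) (n : ℕ) : List Bool :=
  (List.range n).map fun i => decide (i ∈ A)

/-- Every string has a program on a universal prefix-free machine. -/
theorem IsUniversalPrefixFreeMachine.exists_program {U : List Bool →. List Bool}
    (hU : IsUniversalPrefixFreeMachine U) (x : List Bool) : ∃ p : List Bool, x ∈ U p := by
  have hM : IsPrefixFreeMachine
      (fun p : List Bool => ((if p = [] then some x else none : Option (List Bool)) :
        Part (List Bool))) := by
    refine ⟨Computable.ofOption (Primrec.to_comp ?_), ?_⟩
    · exact Primrec.ite (Primrec.eq.comp Primrec.id (Primrec.const []))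
        (Primrec.const _) (Primrec.const _)
    · intro p q hp hq _
      have key : ∀ r : List Bool, (((if r = [] then some x else none : Option (List Bool)) :
        Part (List Bool))).Dom → r = [] := by
        intro r hr
        by_contra h
        simp [h] at hr
      rw [key p hp, key q hq]
  obtain ⟨c, hc⟩ := hU.universal _ hM
  obtain ⟨q, hq, _⟩ := hc [] x (by simp)
  exact ⟨q, hq⟩

namespace UniversalMachineExistence

/-- `z` enumerates a string other than `q` that is comparable with `q`. -/
def Clash (z : Option (List Bool × List Bool)) (q : List Bool) : Prop :=
  ∃ w ∈ z.toList, w.1 ≠ q ∧ (w.1 <+: q ∨ q <+: w.1)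

open Classical in
/-- The value accepted for `q` at step `t` of an enumeration of a graph, if any. -/
noncomputable def accept (step : ℕ → Option (List Bool × List Bool)) (q : List Bool) (t : ℕ) :
    Option (List Bool) :=
  (step t).bind fun z => if z.1 = q ∧ ∀ t' < t, ¬ Clash (step t') q then some z.2 else none

theorem primrec_clash : PrimrecRel Clash := by
  have hpre : PrimrecRel fun a b : List Bool => a <+: b := by
    refine (Primrec.eq.comp₂ Primrec₂.left
      (Primrec.list_take.comp₂ (Primrec.list_length.comp₂ Primrec₂.left) Primrec₂.right)).of_eq ?_
    intro a b
    exact List.prefix_iff_eq_take.symm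
  have h : PrimrecRel fun (w : List Bool × List Bool) (q : List Bool) =>
      w.1 ≠ q ∧ (w.1 <+: q ∨ q <+: w.1) := by
    have h1 : Primrec₂ fun (w : List Bool × List Bool) (_ : List Bool) => w.1 :=
      Primrec.fst.comp Primrec.fst
    have a := (Primrec.eq (α := List Bool)).not.comp₂ h1 Primrec₂.right
    have b := hpre.comp₂ h1 Primrec₂.right
    have c := hpre.comp₂ Primrec₂.right h1
    exact PrimrecPred.and a (PrimrecPred.or b c)
  exact (h.exists_mem_list).comp₂ (Primrec.optionToList.comp₂ Primrec₂.left) Primrec₂.right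

theorem primrec_accept {step : ℕ → Option (List Bool × List Bool)} (hs : Primrec step) :
    Primrec₂ (accept step) := by
  classical
  have h1 : PrimrecRel fun (t : ℕ) (q : List Bool) => ∀ t' < t, ¬ Clash (step t') q := by
    have h0 : PrimrecRel fun (t' : ℕ) (q : List Bool) => ¬ Clash (step t') q :=
      (primrec_clash.not).comp₂ (hs.comp₂ Primrec₂.left) Primrec₂.right
    exact (h0.forall_mem_list.comp₂ (Primrec.list_range.comp₂ Primrec₂.left)
      Primrec₂.right).of_eq fun t q => by simp
  refine Primrec.option_bind (hs.comp Primrec.snd) ?_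
  refine Primrec.ite ?_ (Primrec.option_some.comp (Primrec.snd.comp Primrec.snd))
    (Primrec.const none)
  refine PrimrecPred.and ?_ ?_
  · exact Primrec.eq.comp (Primrec.fst.comp Primrec.snd) (Primrec.fst.comp Primrec.fst)
  · exact h1.comp (Primrec.snd.comp Primrec.fst) (Primrec.fst.comp Primrec.fst)

/-- The prefix-free machine extracted from an enumeration of a graph. -/
noncomputable def machine (step : ℕ → Option (List Bool × List Bool)) : List Bool →. List Bool :=
  fun q => Nat.rfindOpt (accept step q)

theorem mem_accept {step : ℕ → Option (List Bool × List Bool)} {q : List Bool} {t : ℕ}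
    {y : List Bool} :
    y ∈ accept step q t ↔ step t = some (q, y) ∧ ∀ t' < t, ¬ Clash (step t') q := by
  classical
  unfold accept
  rcases hst : step t with _ | ⟨a, b⟩
  · simp
  · by_cases h : a = q ∧ ∀ t' < t, ¬ Clash (step t') q
    · have h2 := h.2
      rw [Option.bind_some, if_pos h]
      simp only [Option.mem_def, Option.some.injEq, Prod.mk.injEq, h.1, true_and]
      exact ⟨fun hb => ⟨hb, h2⟩, fun hb => hb.1⟩
    · simp only [Option.bind_some, h, if_false]
      simp only [Option.mem_def, reduceCtorEq, false_iff, Option.some.injEq, Prod.mk.injEq]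
      exact fun hh => h ⟨hh.1.1, hh.2⟩

theorem machine_isPrefixFree {step : ℕ → Option (List Bool × List Bool)} (hs : Primrec step) :
    IsPrefixFreeMachine (machine step) := by
  refine ⟨Partrec.rfindOpt (primrec_accept hs).to_comp, ?_⟩
  intro p q hp hq hpq
  by_contra hne
  obtain ⟨t, y, ht⟩ := Nat.rfindOpt_dom.1 hp
  obtain ⟨s, z, hz⟩ := Nat.rfindOpt_dom.1 hq
  obtain ⟨ht1, ht2⟩ := mem_accept.1 ht
  obtain ⟨hz1, hz2⟩ := mem_accept.1 hz
  rcases lt_trichotomy t s with h | h | h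
  · exact hz2 t h ⟨(p, y), by simp [ht1], hne, Or.inl hpq⟩
  · subst h
    rw [ht1] at hz1
    simp at hz1
    exact hne hz1.1
  · exact ht2 s h ⟨(q, z), by simp [hz1], Ne.symm hne, Or.inr hpq⟩

theorem mem_machine {step : ℕ → Option (List Bool × List Bool)} {q y : List Bool} {t : ℕ}
    (ht : step t = some (q, y)) (hf : ∀ s z, step s = some (q, z) → z = y)
    (hc : ∀ s, ¬ Clash (step s) q) : y ∈ machine step q := by
  have hd : (machine step q).Dom := Nat.rfindOpt_dom.2 ⟨t, y, mem_accept.2 ⟨ht, fun s _ => hc s⟩⟩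
  obtain ⟨s, hs⟩ := Nat.rfindOpt_spec (Part.get_mem hd)
  have := hf s _ (mem_accept.1 hs).1
  rw [← this]
  exact Part.get_mem hd

/-- The header `0^e 1` of the `e`-th machine. -/
def header (e : ℕ) : List Bool := (List.range e).map (fun _ => false) ++ [true]

/-- Enumeration of the graph of the machine running program number `e` on `p` at input `0^e 1 p`. -/
def univStep (t : ℕ) : Option (List Bool × List Bool) :=
  (Encodable.decode (α := (ℕ × ℕ) × List Bool) t).bind fun a =>
    (Nat.Partrec.Code.evaln a.1.1 (Denumerable.ofNat Nat.Partrec.Code a.1.2)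
      (Encodable.encode a.2)).bind fun y =>
        (Encodable.decode (α := List Bool) y).map fun x => (header a.1.2 ++ a.2, x)

theorem primrec_univStep : Primrec univStep := by
  have hh : Primrec header :=
    Primrec.list_append.comp
      (Primrec.list_map Primrec.list_range (Primrec.const false).to₂) (Primrec.const [true])
  refine Primrec.option_bind Primrec.decode ?_
  have h2 : Primrec fun p : ℕ × ((ℕ × ℕ) × List Bool) => p.2 := Primrec.snd
  refine Primrec.option_bind ?_ ?_
  · have h4 : Primrec fun p : ℕ × ((ℕ × ℕ) × List Bool) =>
        ((p.2.1.1, Denumerable.ofNat Nat.Partrec.Code p.2.1.2), Encodable.encode p.2.2) :=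
      ((Primrec.fst.comp (Primrec.fst.comp h2)).pair
        ((Primrec.ofNat _).comp (Primrec.snd.comp (Primrec.fst.comp h2)))).pair
        (Primrec.encode.comp (Primrec.snd.comp h2))
    exact Nat.Partrec.Code.primrec_evaln.comp h4
  · refine Primrec.option_map ((Primrec.decode (α := List Bool)).comp Primrec.snd) ?_
    have h3 : Primrec fun p : ((ℕ × ((ℕ × ℕ) × List Bool)) × ℕ) × List Bool => p.1.1.2 :=
      Primrec.snd.comp (Primrec.fst.comp Primrec.fst)
    exact (Primrec.list_append.comp (hh.comp (Primrec.snd.comp (Primrec.fst.comp h3)))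
      (Primrec.snd.comp h3)).pair Primrec.snd

theorem header_cancel : ∀ {d e : ℕ} {p q : List Bool},
    header d ++ p <+: header e ++ q → d = e ∧ p <+: q := by
  have hs : ∀ e, header (e + 1) = false :: header e := by
    intro e
    simp [header, List.map_const', List.replicate_succ]
  have h0 : header 0 = [true] := rfl
  intro d
  induction d with
  | zero =>
    intro e p q h
    cases e with
    | zero => simpa [h0] using h
    | succ e => simp [h0, hs] at h
  | succ d ih =>
    intro e p q h
    cases e with
    | zero => simp [h0, hs] at h
    | succ e =>
      rw [hs, hs, List.cons_append, List.cons_append, List.cons_prefix_cons] at h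
      have := ih h.2
      exact ⟨by rw [this.1], this.2⟩

theorem mem_univStep {t : ℕ} {w : List Bool × List Bool} (h : univStep t = some w) :
    ∃ (e : ℕ) (p : List Bool), w.1 = header e ++ p ∧
      Encodable.encode w.2 ∈
        (Nat.Partrec.Code.eval (Denumerable.ofNat Nat.Partrec.Code e) (Encodable.encode p)).bind
          (fun y => ((Encodable.decode (α := List Bool) y).map Encodable.encode : Option ℕ)) := by
  unfold univStep at h
  simp only [Option.bind_eq_some_iff, Option.map_eq_some_iff] at h
  obtain ⟨⟨⟨k, e⟩, p⟩, _, y, hy, x, hx, rfl⟩ := h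
  refine ⟨e, p, rfl, ?_⟩
  rw [Part.mem_bind_iff]
  exact ⟨y, Nat.Partrec.Code.evaln_sound hy, by simp [hx]⟩

end UniversalMachineExistence

open UniversalMachineExistence in
/-- Universal prefix-free machines exist. -/
theorem exists_isUniversalPrefixFreeMachine :
    ∃ U : List Bool →. List Bool, IsUniversalPrefixFreeMachine U := by
  refine ⟨machine univStep, machine_isPrefixFree primrec_univStep, ?_⟩
  intro M hM
  obtain ⟨c, hc⟩ := Nat.Partrec.Code.exists_code.1 hM.partrec
  have hev : ∀ p : List Bool, c.eval (Encodable.encode p) = (M p).map Encodable.encode := by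
    intro p
    rw [hc]
    simp
  refine ⟨(header (Encodable.encode c)).length, ?_⟩
  intro p x hx
  refine ⟨header (Encodable.encode c) ++ p, ?_, by simp [add_comm]⟩
  have key : ∀ s r z, univStep s = some (header (Encodable.encode c) ++ r, z) → z ∈ M r := by
    intro s r z h
    obtain ⟨e, p', he, hy⟩ := mem_univStep h
    simp only at he hy
    obtain ⟨h1, h2⟩ := header_cancel (he ▸ List.prefix_refl _ :
      header (Encodable.encode c) ++ r <+: header e ++ p')
    subst h1
    have h3 : r = p' := List.append_cancel_left he
    subst h3
    rw [Denumerable.ofNat_encode, hev] at hy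
    simpa using hy
  have hxe : Encodable.encode x ∈ c.eval (Encodable.encode p) := by
    rw [hev]
    exact Part.mem_map _ hx
  obtain ⟨k, hk⟩ := Nat.Partrec.Code.evaln_complete.1 hxe
  have ht : univStep (Encodable.encode ((k, Encodable.encode c), p)) =
      some (header (Encodable.encode c) ++ p, x) := by
    have hk' : Nat.Partrec.Code.evaln k c (Encodable.encode p) = some (Encodable.encode x) := hk
    unfold univStep
    rw [Encodable.encodek]
    simp [hk']
  refine mem_machine ht (fun s z hz => Part.mem_unique (key s p z hz) hx) ?_
  rintro s ⟨w, hw, hne, hcl⟩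
  have hw' : univStep s = some w := by simpa using hw
  obtain ⟨e, p', he, _⟩ := mem_univStep hw'
  have hde : e = Encodable.encode c ∧ (p' <+: p ∨ p <+: p') := by
    rw [he] at hcl
    rcases hcl with h | h
    · exact ⟨(header_cancel h).1, Or.inl (header_cancel h).2⟩
    · exact ⟨(header_cancel h).1.symm, Or.inr (header_cancel h).2⟩
  obtain ⟨rfl, hpp⟩ := hde
  have hmem : w.2 ∈ M p' := key s p' w.2 (by rw [hw', ← he])
  have : p' = p := by
    rcases hpp with h | h
    · exact hM.prefixFree p' p hmem.1 hx.1 h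
    · exact (hM.prefixFree p p' hx.1 hmem.1 h).symm
  exact hne (by rw [he, this])

/-!
The initial segment `A↾n` of an enumerable set `A` is determined by `n` and by the number of
elements of `A` below `n`: enumerate `A` until that many have appeared. If `∑ 2 ^ (-h n)` converges,
the lengths `n` have a computable prefix code with codewords of `h n + O(1)` bits; as `h` is
monotone, the binary expansions of the partial sums, cut off at the right length, are such a code
(`codeword_prefixFree`). The number of elements takes another `log n + O(1)` bits, which gives the
upper bound (`complexity_le_of_summable`).

Conversely, one enumerable set `A` serves against all constants `c` (`CostlySet.exists_set`). The
numbers `2 ^ c * (2 * j + 1)` are reserved for `c`. Such a number `x` is put into `A` as soon as the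
present initial segments of all lengths `n` with `x < n ≤ 4 * x` are seen to have programs of length
at most `h n + log n + c`. If `c` is a valid constant for `A`, then every number reserved for `c` is
eventually enumerated. The initial segments of length `n` present when the different `x < n` enter
are distinct strings, since each entry changes the segment for good. A positive fraction, about
`2 ^ (-c - 3)`, of the numbers up to `n` is reserved for `c` and has `x < n ≤ 4 * x`; so the strings
of length `n` contribute at least a constant times `n * 2 ^ (-h n - log n)`, hence a constant times
`2 ^ (-h n)`, to the Kraft sum of the universal machine. That sum is at most `1`, and therefore
`∑ 2 ^ (-h n)` converges (`summable_of_distinct_strings`).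
-/

/-! ### Computability of the basic operations -/

theorem Primrec.nat_pow : Primrec₂ ((· ^ ·) : ℕ → ℕ → ℕ) :=
  Primrec₂.unpaired'.1 Nat.Primrec.pow

theorem Primrec.nat_log_two : Primrec (Nat.log 2) := by
  have hp : PrimrecRel fun n k : ℕ => 2 ^ k ≤ n :=
    Primrec.nat_le.comp₂ (Primrec.nat_pow.comp₂ (Primrec₂.const 2) Primrec₂.right) Primrec₂.left
  refine (Primrec.nat_findGreatest (f := id) Primrec.id hp).of_eq fun n => ?_
  rcases Nat.eq_zero_or_pos n with rfl | hn
  · simp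
  · rw [id, Nat.findGreatest_eq_iff]
    refine ⟨Nat.log_le_self 2 n, fun _ => Nat.pow_log_le_self 2 hn.ne', fun k hk _ => ?_⟩
    exact not_le.2 (Nat.lt_pow_of_log_lt one_lt_two hk)

/-- A recursively enumerable predicate is the projection of a primitive recursive relation: the
witness is the number of steps after which a fixed program halts. -/
theorem REPred.exists_primrecRel {α : Type*} [Primcodable α] {p : α → Prop} (hp : REPred p) :
    ∃ R : α → ℕ → Prop, PrimrecRel R ∧ ∀ a, p a ↔ ∃ t, R a t := by
  obtain ⟨c, hc⟩ := Nat.Partrec.Code.exists_code.1 hp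
  have hdom : ∀ a, p a ↔ (c.eval (Encodable.encode a)).Dom := by
    intro a
    rw [hc]
    simp [Part.assert]
  refine ⟨fun a t => (Nat.Partrec.Code.evaln t c (Encodable.encode a)).isSome = true, ?_, ?_⟩
  · refine ⟨inferInstance, ?_⟩
    have h1 : Primrec fun q : α × ℕ => Nat.Partrec.Code.evaln q.2 c (Encodable.encode q.1) :=
      Nat.Partrec.Code.primrec_evaln.comp
        ((Primrec.snd.pair (Primrec.const c)).pair (Primrec.encode.comp Primrec.fst))
    exact (Primrec.option_isSome.comp h1).of_eq fun q => by simp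
  · intro a
    rw [hdom, Part.dom_iff_mem]
    simp only [Nat.Partrec.Code.evaln_complete, Option.isSome_iff_exists, Option.mem_def]
    exact exists_comm

theorem PrimrecRel.rePred_exists {α : Type*} [Primcodable α] {R : α → ℕ → Prop}
    (hR : PrimrecRel R) : REPred fun a => ∃ t, R a t := by
  classical
  have h1 : Partrec fun a => Nat.rfind fun t => Part.some (decide (R a t)) :=
    Partrec.rfind (Computable.partrec hR.decide.to_comp)
  refine h1.dom_re.of_eq fun a => ?_
  refine Nat.rfind_dom'.trans ?_
  simp

/-! ### Initial segments -/

@[simp] theorem length_initialSegment (A : Set ℕ) (n : ℕ) : (initialSegment A n).length = n := by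
  simp [initialSegment]

theorem initialSegment_eq_iff {A B : Set ℕ} {n : ℕ} :
    initialSegment A n = initialSegment B n ↔ ∀ i < n, (i ∈ A ↔ i ∈ B) := by
  simp [initialSegment, List.map_inj_left]

theorem PrimrecRel.primrec₂_initialSegment {α : Type*} [Primcodable α] {B : α → ℕ → Prop}
    (hB : PrimrecRel B) : Primrec₂ fun a n => initialSegment {i | B a i} n := by
  classical
  have h1 : Primrec fun q : α × ℕ => (List.range q.2).map fun i => decide (B q.1 i) :=
    Primrec.list_map (Primrec.list_range.comp Primrec.snd)
      (hB.decide.comp (Primrec.fst.comp Primrec.fst) Primrec.snd)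
  refine h1.of_eq fun q => ?_
  simp [initialSegment]

theorem count_true_initialSegment (A : Set ℕ) [DecidablePred (· ∈ A)] (n : ℕ) :
    (initialSegment A n).count true = ((Finset.range n).filter (· ∈ A)).card := by
  induction n with
  | zero => simp [initialSegment]
  | succ n ih =>
    have h1 : initialSegment A (n + 1) = initialSegment A n ++ [decide (n ∈ A)] := by
      simp [initialSegment, List.range_succ]
    rw [h1, List.count_append, ih, Finset.range_add_one, Finset.filter_insert]
    by_cases h : n ∈ A <;> simp [h]

/-- A subset with as many elements below `n` has the same initial segment of length `n`. This is
why the number of elements below `n` suffices to describe an initial segment of an enumerable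
set. -/
theorem initialSegment_eq_of_count {A B : Set ℕ} {n : ℕ} (hAB : A ⊆ B)
    (h : (initialSegment A n).count true = (initialSegment B n).count true) :
    initialSegment A n = initialSegment B n := by
  classical
  rw [count_true_initialSegment, count_true_initialSegment] at h
  have hsub : (Finset.range n).filter (· ∈ A) ⊆ (Finset.range n).filter (· ∈ B) :=
    Finset.monotone_filter_right _ fun i _ hi => hAB hi
  have heq := Finset.eq_of_subset_of_card_le hsub h.ge
  rw [initialSegment_eq_iff]
  intro i hi
  simpa [hi] using Finset.ext_iff.1 heq i

/-! ### Binary expansions of fixed length -/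

/-- The `L` least significant binary digits of `m`, most significant digit first. -/
def fixedBits (L m : ℕ) : List Bool :=
  (List.range L).map fun i => decide (m / 2 ^ (L - 1 - i) % 2 = 1)

@[simp] theorem length_fixedBits (L m : ℕ) : (fixedBits L m).length = L := by simp [fixedBits]

theorem primrec₂_fixedBits : Primrec₂ fixedBits := by
  have h1 : PrimrecRel fun (q : ℕ × ℕ) (i : ℕ) => q.2 / 2 ^ (q.1 - 1 - i) % 2 = 1 := by
    refine Primrec.eq.comp₂ (Primrec.nat_mod.comp₂ (Primrec.nat_div.comp₂
      (Primrec.snd.comp₂ Primrec₂.left) (Primrec.nat_pow.comp₂ (Primrec₂.const 2) ?_))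
      (Primrec₂.const 2)) (Primrec₂.const 1)
    exact Primrec.nat_sub.comp₂ (Primrec.nat_sub.comp₂ (Primrec.fst.comp₂ Primrec₂.left)
      (Primrec₂.const 1)) Primrec₂.right
  exact Primrec.list_map (Primrec.list_range.comp Primrec.fst) h1.decide

theorem fixedBits_injOn (L : ℕ) : Set.InjOn (fixedBits L) (Set.Iio (2 ^ L)) := by
  intro a ha b hb hab
  refine Nat.eq_of_testBit_eq fun i => ?_
  rcases lt_or_ge i L with hi | hi
  · have h1 := congrArg (fun l : List Bool => l[L - 1 - i]?) hab
    have h2 : L - 1 - i < L := by omega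
    have h3 : L - 1 - (L - 1 - i) = i := by omega
    simpa [fixedBits, h2, h3, Nat.testBit_eq_decide_div_mod_eq] using h1
  · have h1 : 2 ^ L ≤ 2 ^ i := Nat.pow_le_pow_right two_pos hi
    rw [Nat.testBit_lt_two_pow (lt_of_lt_of_le ha h1),
      Nat.testBit_lt_two_pow (lt_of_lt_of_le hb h1)]

theorem take_fixedBits {k L : ℕ} (hkL : k ≤ L) (m : ℕ) :
    (fixedBits L m).take k = fixedBits k (m / 2 ^ (L - k)) := by
  unfold fixedBits
  rw [← List.map_take, List.take_range, min_eq_left hkL]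
  refine List.map_congr_left fun i hi => ?_
  rw [List.mem_range] at hi
  rw [Nat.div_div_eq_div_mul, ← pow_add]
  congr 5
  omega

/-! ### A prefix code with prescribed monotone lengths -/

/-- The integer `2 ^ h n * ∑ i < n, 2 ^ (-h i)`, for monotone `h`. -/
def codeIndex (h : ℕ → ℕ) : ℕ → ℕ
  | 0 => 0
  | n + 1 => (codeIndex h n + 1) * 2 ^ (h (n + 1) - h n)

theorem computable_codeIndex {h : ℕ → ℕ} (hh : Computable h) : Computable (codeIndex h) := by
  have h1 : Computable₂ fun (_ : ℕ) (q : ℕ × ℕ) => (q.2 + 1) * 2 ^ (h (q.1 + 1) - h q.1) := by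
    have hq : Computable fun q : ℕ × (ℕ × ℕ) => q.2.1 := Computable.fst.comp Computable.snd
    have hr : Computable fun q : ℕ × (ℕ × ℕ) => q.2.2 := Computable.snd.comp Computable.snd
    exact Primrec.nat_mul.to_comp.comp (Computable.succ.comp hr)
      (Primrec.nat_pow.to_comp.comp (Computable.const 2)
        (Primrec.nat_sub.to_comp.comp (hh.comp (Computable.succ.comp hq)) (hh.comp hq)))
  refine (Computable.nat_rec Computable.id (Computable.const 0) h1).of_eq fun n => ?_
  induction n with
  | zero => rfl
  | succ n ih => simp only [codeIndex, ← ih]; rfl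

theorem codeIndex_eq {h : ℕ → ℕ} (hm : Monotone h) (n : ℕ) :
    (codeIndex h n : ℝ) = 2 ^ h n * ∑ i ∈ Finset.range n, (2 ^ h i : ℝ)⁻¹ := by
  induction n with
  | zero => simp [codeIndex]
  | succ n ih =>
    have h1 : (2 : ℝ) ^ h (n + 1) = 2 ^ h n * 2 ^ (h (n + 1) - h n) := by
      rw [← pow_add, Nat.add_sub_cancel' (hm n.le_succ)]
    rw [codeIndex, Finset.sum_range_succ, h1]
    push_cast
    rw [ih]
    field_simp

theorem codeIndex_lt_codeIndex {h : ℕ → ℕ} (hm : Monotone h) {n m : ℕ} (hnm : n < m) :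
    (codeIndex h n + 1) * 2 ^ (h m - h n) ≤ codeIndex h m := by
  induction m, hnm using Nat.le_induction with
  | base => exact le_rfl
  | succ m hnm ih =>
    have h1 : h (m + 1) - h n = (h m - h n) + (h (m + 1) - h m) := by
      have := hm (Nat.le_of_succ_le hnm)
      have := hm (Nat.le_add_right m 1)
      omega
    rw [h1, pow_add, ← mul_assoc, codeIndex]
    exact Nat.mul_le_mul_right _ (ih.trans (Nat.le_succ _))

/-- The Shannon–Fano codeword of `n`, of length `h n + b`: the binary expansion of
`2 ^ (-b) * ∑ i < n, 2 ^ (-h i)`. No rounding is needed because `h` is monotone. -/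
def codeword (h : ℕ → ℕ) (b n : ℕ) : List Bool := fixedBits (h n + b) (codeIndex h n)

@[simp] theorem length_codeword (h : ℕ → ℕ) (b n : ℕ) : (codeword h b n).length = h n + b := by
  simp [codeword]

theorem computable_codeword {h : ℕ → ℕ} (hh : Computable h) (b : ℕ) :
    Computable (codeword h b) :=
  primrec₂_fixedBits.to_comp.comp
    (Primrec.nat_add.to_comp.comp hh (Computable.const b)) (computable_codeIndex hh)

theorem codeIndex_lt_two_pow {h : ℕ → ℕ} (hm : Monotone h) {b : ℕ}
    (hb : ∀ n, ∑ i ∈ Finset.range n, (2 ^ h i : ℝ)⁻¹ ≤ 2 ^ b) (n : ℕ) :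
    codeIndex h n < 2 ^ (h n + b) := by
  have h1 := hb (n + 1)
  rw [Finset.sum_range_succ] at h1
  have h2 : (codeIndex h n : ℝ) < 2 ^ (h n + b) := by
    rw [codeIndex_eq hm, pow_add]
    have : (0 : ℝ) < (2 ^ h n)⁻¹ := by positivity
    gcongr
    linarith
  exact_mod_cast h2

theorem codeword_prefixFree {h : ℕ → ℕ} (hm : Monotone h) {b : ℕ}
    (hb : ∀ n, ∑ i ∈ Finset.range n, (2 ^ h i : ℝ)⁻¹ ≤ 2 ^ b) {n m : ℕ}
    (hp : codeword h b n <+: codeword h b m) : n = m := by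
  have key : ∀ n m, n < m → ¬ codeword h b n <+: codeword h b m := by
    intro n m hnm hp
    have hle : h n ≤ h m := hm hnm.le
    have h1 := List.prefix_iff_eq_take.1 hp
    rw [length_codeword, codeword, codeword, take_fixedBits (by omega)] at h1
    have h2 : h m + b - (h n + b) = h m - h n := by omega
    rw [h2] at h1
    have h3 : codeIndex h m / 2 ^ (h m - h n) < 2 ^ (h n + b) := by
      rw [Nat.div_lt_iff_lt_mul (by positivity), ← pow_add]
      have h4 : h n + b + (h m - h n) = h m + b := by omega
      rw [h4]
      exact codeIndex_lt_two_pow hm hb m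
    have h5 := fixedBits_injOn _ (codeIndex_lt_two_pow hm hb n) h3 h1
    have h6 := (Nat.le_div_iff_mul_le (by positivity)).2 (codeIndex_lt_codeIndex hm hnm)
    omega
  rcases lt_trichotomy n m with hlt | heq | hgt
  · exact absurd hp (key n m hlt)
  · exact heq
  · have hlen : (codeword h b m).length ≤ (codeword h b n).length := by
      have := hm hgt.le
      simpa using this
    have := hp.eq_of_length_le hlen
    exact absurd (this ▸ List.prefix_refl _) (key m n hgt)

/-! ### Short descriptions of initial segments of enumerable sets -/

/-- The description of `σ`: a codeword for its length, followed by the number of its ones. -/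
def describe (h : ℕ → ℕ) (b : ℕ) (σ : List Bool) : List Bool :=
  codeword h b σ.length ++ fixedBits (Nat.log 2 σ.length + 1) (σ.count true)

theorem length_describe (h : ℕ → ℕ) (b : ℕ) (σ : List Bool) :
    (describe h b σ).length = h σ.length + b + (Nat.log 2 σ.length + 1) := by
  simp [describe]

theorem computable_describe {h : ℕ → ℕ} (hh : Computable h) (b : ℕ) :
    Computable (describe h b) := by
  have h1 : Primrec fun σ : List Bool => σ.count true := by
    have h2 : Primrec fun σ : List Bool => σ.filter (fun x => decide (x = true)) :=
      Primrec.listFilter (Primrec.eq.comp Primrec.id (Primrec.const true))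
    refine (Primrec.list_length.comp h2).of_eq fun σ => ?_
    rw [List.count_eq_countP, List.countP_eq_length_filter]
    congr 2
  have hlen : Primrec fun σ : List Bool => σ.length := Primrec.list_length
  exact Computable.list_append.comp ((computable_codeword hh b).comp hlen.to_comp)
    (primrec₂_fixedBits.comp (Primrec.succ.comp (Primrec.nat_log_two.comp hlen)) h1).to_comp

/-- The length determines the codeword and the width of the count, so that the domain of the machine
below is prefix-free and a description determines both numbers. -/
theorem describe_prefixFree {h : ℕ → ℕ} (hm : Monotone h) {b : ℕ}
    (hb : ∀ n, ∑ i ∈ Finset.range n, (2 ^ h i : ℝ)⁻¹ ≤ 2 ^ b) {σ τ : List Bool}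
    (hp : describe h b σ <+: describe h b τ) :
    σ.length = τ.length ∧ σ.count true = τ.count true := by
  have hlen : σ.length = τ.length := by
    have h1 : codeword h b σ.length <+: describe h b τ := (List.prefix_append _ _).trans hp
    have h2 : codeword h b τ.length <+: describe h b τ := List.prefix_append _ _
    rcases List.prefix_or_prefix_of_prefix h1 h2 with h3 | h3
    · exact codeword_prefixFree hm hb h3
    · exact (codeword_prefixFree hm hb h3).symm
  have heq : describe h b σ = describe h b τ :=
    hp.eq_of_length (by rw [length_describe, length_describe, hlen])
  refine ⟨hlen, ?_⟩
  rw [describe, describe, hlen, List.append_cancel_left_eq] at heq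
  have hlt : ∀ ρ : List Bool, ρ.count true < 2 ^ (Nat.log 2 ρ.length + 1) := fun ρ =>
    (List.count_le_length).trans_lt (Nat.lt_pow_succ_log_self one_lt_two _)
  exact fixedBits_injOn _ (hlen ▸ hlt σ) (hlt τ) heq

/-- If `∑ 2 ^ (-h n)` is finite, some prefix-free machine describes every initial segment of an
enumerable set by `h n + log n + O(1)` bits: it reads the length `n` and the number of elements
below `n`, and enumerates the set until that many elements have appeared. -/
theorem exists_machine_initialSegment {h : ℕ → ℕ} (hh : Computable h) (hm : Monotone h) {b : ℕ}
    (hb : ∀ n, ∑ i ∈ Finset.range n, (2 ^ h i : ℝ)⁻¹ ≤ 2 ^ b) {A : Set ℕ}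
    (hA : REPred fun n => n ∈ A) :
    ∃ M, IsPrefixFreeMachine M ∧
      ∀ n, initialSegment A n ∈ M (describe h b (initialSegment A n)) := by
  classical
  obtain ⟨R, hR, hAR⟩ := hA.exists_primrecRel
  let B : ℕ → Set ℕ := fun s => {i | ∃ t < s, R i t}
  have hBA : ∀ s, B s ⊆ A := fun s i ⟨t, _, ht⟩ => (hAR i).2 ⟨t, ht⟩
  have hseg : Primrec₂ fun s n => initialSegment (B s) n := by
    have h1 : PrimrecRel fun s i => ∃ t < s, R i t :=
      (PrimrecRel.exists_lt (R := fun t i => R i t) (hR.comp₂ Primrec₂.right Primrec₂.left))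
    exact h1.primrec₂_initialSegment
  let seg : ℕ → List Bool := fun k => initialSegment (B k.unpair.1) k.unpair.2
  have hsegc : Computable seg :=
    (hseg.comp (Primrec.fst.comp Primrec.unpair) (Primrec.snd.comp Primrec.unpair)).to_comp
  let f : List Bool → ℕ → Option (List Bool) := fun w k =>
    cond (decide (w = describe h b (seg k))) (some (seg k)) none
  have hf : Computable₂ f := by
    have h1 : Computable fun q : List Bool × ℕ => decide (q.1 = describe h b (seg q.2)) :=
      (Primrec.eq (α := List Bool)).decide.to_comp.comp Computable.fst
        ((computable_describe hh b).comp (hsegc.comp Computable.snd))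
    exact Computable.cond h1 (Computable.option_some.comp (hsegc.comp Computable.snd))
      (Computable.const none)
  have hmem : ∀ w k σ, σ ∈ f w k ↔ w = describe h b (seg k) ∧ σ = seg k := by
    intro w k σ
    by_cases hw : w = describe h b (seg k) <;> simp [f, hw, eq_comm]
  refine ⟨fun w => Nat.rfindOpt (f w), ⟨Partrec.rfindOpt hf, ?_⟩, ?_⟩
  · intro p q hp hq hpq
    obtain ⟨k, σ, hk⟩ := Nat.rfindOpt_dom.1 hp
    obtain ⟨l, τ, hl⟩ := Nat.rfindOpt_dom.1 hq
    rw [hmem] at hk hl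
    rw [hk.1, hl.1] at hpq ⊢
    obtain ⟨h1, h2⟩ := describe_prefixFree hm hb hpq
    rw [describe, describe, h1, h2]
  · intro n
    -- at some stage all the elements of `A` below `n` have been enumerated
    have hstage : ∃ s, initialSegment (B s) n = initialSegment A n := by
      choose! T hT using fun i (hi : i ∈ A) => (hAR i).1 hi
      refine ⟨(Finset.range n).sup T + 1, initialSegment_eq_iff.2 fun i hi =>
        ⟨fun h => hBA _ h, fun h => ⟨T i, ?_, hT i h⟩⟩⟩
      exact Nat.lt_succ_of_le (Finset.le_sup (f := T) (Finset.mem_range.2 hi))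
    obtain ⟨s, hs⟩ := hstage
    have hdom : (Nat.rfindOpt (f (describe h b (initialSegment A n)))).Dom := by
      refine Nat.rfindOpt_dom.2 ⟨Nat.pair s n, initialSegment A n, (hmem _ _ _).2 ?_⟩
      simp [seg, hs]
    obtain ⟨k, hk⟩ := Nat.rfindOpt_spec (Part.get_mem hdom)
    obtain ⟨hk1, hk2⟩ := (hmem _ _ _).1 hk
    have hpre : describe h b (initialSegment A n) <+: describe h b (seg k) :=
      hk1 ▸ List.prefix_refl _
    obtain ⟨h1, h2⟩ := describe_prefixFree hm hb hpre
    have h3 : seg k = initialSegment A n := by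
      have hn : k.unpair.2 = n := by simpa [seg] using h1.symm
      simp only [seg, hn] at h2 ⊢
      exact initialSegment_eq_of_count (hBA _) h2.symm
    have h4 := Part.get_mem hdom
    rwa [hk2, h3] at h4

/-- The upper bound: if `∑ 2 ^ (-h n)` converges, the initial segments of every enumerable set have
complexity at most `h n + log n + O(1)`. -/
theorem complexity_le_of_summable {U : List Bool →. List Bool}
    (hU : IsUniversalPrefixFreeMachine U) {h : ℕ → ℕ} (hh : Computable h) (hm : Monotone h)
    (hs : Summable fun n => (2 ^ h n : ℝ)⁻¹) {A : Set ℕ} (hA : REPred fun n => n ∈ A) :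
    ∃ c : ℕ, ∀ n, prefixFreeComplexity U (initialSegment A n) ≤ h n + Nat.log 2 n + c := by
  obtain ⟨b, hb⟩ := pow_unbounded_of_one_lt (∑' n, (2 ^ h n : ℝ)⁻¹) one_lt_two
  have hb' : ∀ n, ∑ i ∈ Finset.range n, (2 ^ h i : ℝ)⁻¹ ≤ 2 ^ b := fun n =>
    (hs.sum_le_tsum _ fun i _ => by positivity).trans hb.le
  obtain ⟨M, hM, hMA⟩ := exists_machine_initialSegment hh hm hb' hA
  obtain ⟨d, hd⟩ := hU.universal M hM
  refine ⟨b + 1 + d, fun n => ?_⟩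
  obtain ⟨q, hq, hqd⟩ := hd _ _ (hMA n)
  rw [length_describe, length_initialSegment] at hqd
  have := Nat.sInf_le (s := {l | ∃ p, initialSegment A n ∈ U p ∧ p.length = l}) ⟨q, hq, rfl⟩
  unfold prefixFreeComplexity
  omega

/-! ### The Kraft inequality for prefix-free machines -/

open InformationTheory in
theorem uniquelyDecodable_of_prefixFree {S : Set (List Bool)}
    (hS : ∀ p ∈ S, ∀ q ∈ S, p <+: q → p = q) (hnil : [] ∉ S) : UniquelyDecodable S := by
  intro L₁
  induction L₁ with
  | nil =>
    intro L₂ _ h₂ h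
    rcases L₂ with _ | ⟨w, L₂⟩
    · rfl
    · have hw : w = [] := by simp_all
      exact absurd (hw ▸ h₂ w (by simp)) hnil
  | cons v L₁ ih =>
    intro L₂ h₁ h₂ h
    rcases L₂ with _ | ⟨w, L₂⟩
    · have hv : v = [] := by simp_all
      exact absurd (hv ▸ h₁ v (by simp)) hnil
    · have hvS := h₁ v (by simp)
      have hwS := h₂ w (by simp)
      rw [List.flatten_cons, List.flatten_cons] at h
      have hv : v <+: w ++ L₂.flatten := h ▸ List.prefix_append _ _
      have hvw : v = w := by
        rcases List.prefix_or_prefix_of_prefix hv (List.prefix_append _ _) with h3 | h3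
        · exact hS v hvS w hwS h3
        · exact (hS w hwS v hvS h3).symm
      subst hvw
      rw [List.append_cancel_left_eq] at h
      rw [ih L₂ (fun x hx => h₁ x (by simp [hx])) (fun x hx => h₂ x (by simp [hx])) h]

theorem sum_inv_two_pow_length_le_one {S : Finset (List Bool)}
    (hS : ∀ p ∈ S, ∀ q ∈ S, p <+: q → p = q) : ∑ p ∈ S, (2 ^ p.length : ℝ)⁻¹ ≤ 1 := by
  by_cases hnil : [] ∈ S
  · have : S = {[]} := Finset.eq_singleton_iff_unique_mem.2
      ⟨hnil, fun q hq => (hS [] hnil q hq List.nil_prefix).symm⟩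
    simp [this]
  · have := InformationTheory.kraft_mcmillan_inequality
      (uniquelyDecodable_of_prefixFree (S := (S : Set (List Bool))) hS hnil)
    simpa using this

/-- If distinct strings `σ i` have programs of length at most `l i` on a prefix-free machine, then
`∑ 2 ^ (-l i) ≤ 1`. -/
theorem IsPrefixFreeMachine.sum_le_one {M : List Bool →. List Bool} (hM : IsPrefixFreeMachine M)
    {ι : Type*} (s : Finset ι) {σ : ι → List Bool} (hσ : Set.InjOn σ s) {l : ι → ℕ}
    (hl : ∀ i ∈ s, ∃ p, σ i ∈ M p ∧ p.length ≤ l i) : ∑ i ∈ s, (2 ^ l i : ℝ)⁻¹ ≤ 1 := by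
  classical
  choose! p hp hpl using hl
  have hinj : Set.InjOn p s := fun i hi j hj hij =>
    hσ hi hj (Part.mem_unique (hp i hi) (hij ▸ hp j hj))
  calc ∑ i ∈ s, (2 ^ l i : ℝ)⁻¹ ≤ ∑ i ∈ s, (2 ^ (p i).length : ℝ)⁻¹ := by
        refine Finset.sum_le_sum fun i hi => ?_
        gcongr
        · norm_num
        · exact hpl i hi
    _ = ∑ w ∈ s.image p, (2 ^ w.length : ℝ)⁻¹ :=
        (Finset.sum_image (f := fun w : List Bool => (2 ^ w.length : ℝ)⁻¹) hinj).symm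
    _ ≤ 1 := by
        refine sum_inv_two_pow_length_le_one fun v hv w hw hvw => ?_
        obtain ⟨i, hi, rfl⟩ := Finset.mem_image.1 hv
        obtain ⟨j, hj, rfl⟩ := Finset.mem_image.1 hw
        exact hM.prefixFree _ _ (hp i hi).1 (hp j hj).1 hvw

/-! ### An enumerable set with costly initial segments -/

namespace CostlySet

/-- The `j`-th element reserved for the requirement that `c` is not an upper bound for the
constant. -/
def element (c j : ℕ) : ℕ := 2 ^ c * (2 * j + 1)

theorem element_injective {c j c' j' : ℕ} (h : element c j = element c' j') : c = c' ∧ j = j' := by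
  induction c generalizing c' with
  | zero =>
    cases c' with
    | zero => simp [element] at h; omega
    | succ c' => simp only [element, pow_succ, mul_right_comm _ 2] at h; omega
  | succ c ih =>
    cases c' with
    | zero => simp only [element, pow_succ, mul_right_comm _ 2] at h; omega
    | succ c' =>
      have := ih (c' := c') (by simp only [element, pow_succ, mul_right_comm _ 2] at h ⊢; omega)
      omega

/-- The data handled at a stage: the requirement `c`, the index `j` of one of its elements, and a
list of candidate witnesses. -/
def stageData (s : ℕ) : (ℕ × ℕ) × List ℕ := Denumerable.ofNat _ s

/-- The element handled at stage `s`. -/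
def stageElement (s : ℕ) : ℕ := element (stageData s).1.1 (stageData s).1.2

/-- The condition under which stage `s` enumerates its element `x`, when the elements enumerated so
far are those of `E`: `x` is new, and the list of witnesses shows that the present initial segments
of all lengths from `x + 1` to `4 * x` satisfy `R` for the requirement concerned. -/
def Acts (R : ℕ × List Bool → ℕ → Prop) (s : ℕ) (E : List ℕ) : Prop :=
  stageElement s ∉ E ∧ ∀ i ∈ List.range (3 * stageElement s), ∃ z ∈ (stageData s).2,
    R ((stageData s).1.1, initialSegment {x | x ∈ E} (stageElement s + 1 + i)) z

open Classical in
/-- The list of elements enumerated before stage `s`. -/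
noncomputable def enumerated (R : ℕ × List Bool → ℕ → Prop) : ℕ → List ℕ
  | 0 => []
  | s + 1 => if Acts R s (enumerated R s) then stageElement s :: enumerated R s
      else enumerated R s

theorem primrec_stageData : Primrec stageData := Primrec.ofNat _

theorem primrec_stageElement : Primrec stageElement := by
  have h1 : Primrec fun s => (stageData s).1 := Primrec.fst.comp primrec_stageData
  exact Primrec.nat_mul.comp (Primrec.nat_pow.comp (Primrec.const 2) (Primrec.fst.comp h1))
    (Primrec.nat_double_succ.comp (Primrec.snd.comp h1))

theorem primrecRel_mem : PrimrecRel fun (E : List ℕ) (x : ℕ) => x ∈ E :=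
  (PrimrecRel.exists_mem_list (Primrec.eq (α := ℕ))).of_eq fun E x => by simp

/-- The witness condition of `Acts`, with requirement, element, current list and list of witnesses
as independent arguments. -/
theorem primrecPred_witnessed {R : ℕ × List Bool → ℕ → Prop} (hR : PrimrecRel R) :
    PrimrecPred fun b : ((ℕ × ℕ) × List ℕ) × List ℕ => ∀ i ∈ List.range (3 * b.1.1.2),
      ∃ z ∈ b.2, R (b.1.1.1, initialSegment {x | x ∈ b.1.2} (b.1.1.2 + 1 + i)) z := by
  have hseg : Primrec₂ fun (E : List ℕ) n => initialSegment {x | x ∈ E} n :=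
    primrecRel_mem.primrec₂_initialSegment
  have h1 : PrimrecRel fun (L : List ℕ) (a : ((ℕ × ℕ) × List ℕ) × ℕ) =>
      ∃ z ∈ L, R (a.1.1.1, initialSegment {x | x ∈ a.1.2} (a.1.1.2 + 1 + a.2)) z := by
    have h11 : Primrec fun a : ((ℕ × ℕ) × List ℕ) × ℕ => a.1.1 := Primrec.fst.comp Primrec.fst
    have hσ : Primrec fun a : ((ℕ × ℕ) × List ℕ) × ℕ =>
        (a.1.1.1, initialSegment {x | x ∈ a.1.2} (a.1.1.2 + 1 + a.2)) :=
      (Primrec.fst.comp h11).pair (hseg.comp (Primrec.snd.comp Primrec.fst)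
        (Primrec.nat_add.comp (Primrec.succ.comp (Primrec.snd.comp h11)) Primrec.snd))
    exact PrimrecRel.exists_mem_list (R := fun z (a : ((ℕ × ℕ) × List ℕ) × ℕ) =>
      R (a.1.1.1, initialSegment {x | x ∈ a.1.2} (a.1.1.2 + 1 + a.2)) z)
      (hR.comp (hσ.comp Primrec.snd) Primrec.fst)
  have h2 : PrimrecRel fun (i : ℕ) (b : ((ℕ × ℕ) × List ℕ) × List ℕ) => ∃ z ∈ b.2,
      R (b.1.1.1, initialSegment {x | x ∈ b.1.2} (b.1.1.2 + 1 + i)) z :=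
    h1.comp (Primrec.snd.comp Primrec.snd) ((Primrec.fst.comp Primrec.snd).pair Primrec.fst)
  have hx : Primrec fun b : ((ℕ × ℕ) × List ℕ) × List ℕ => b.1.1.2 :=
    Primrec.snd.comp (Primrec.fst.comp Primrec.fst)
  exact h2.forall_mem_list.comp
    (Primrec.list_range.comp (Primrec.nat_mul.comp (Primrec.const 3) hx)) Primrec.id

theorem primrecRel_acts {R : ℕ × List Bool → ℕ → Prop} (hR : PrimrecRel R) :
    PrimrecRel (Acts R) := by
  have hd : Primrec fun q : ℕ × List ℕ => stageData q.1 := primrec_stageData.comp Primrec.fst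
  have hx : Primrec fun q : ℕ × List ℕ => stageElement q.1 := primrec_stageElement.comp Primrec.fst
  have hc : Primrec fun q : ℕ × List ℕ => (stageData q.1).1.1 :=
    Primrec.fst.comp (Primrec.fst.comp hd)
  exact (primrecRel_mem.comp Primrec.snd hx).not.and ((primrecPred_witnessed hR).comp
    (((hc.pair hx).pair Primrec.snd).pair (Primrec.snd.comp hd)))

theorem primrec_enumerated {R : ℕ × List Bool → ℕ → Prop} (hR : PrimrecRel R) :
    Primrec (enumerated R) := by
  classical
  have h1 : Primrec₂ fun s (E : List ℕ) => if Acts R s E then stageElement s :: E else E :=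
    Primrec.ite (primrecRel_acts hR)
      (Primrec.list_cons.comp (primrec_stageElement.comp Primrec.fst) Primrec.snd) Primrec.snd
  refine (Primrec.nat_rec₁ [] h1).of_eq fun s => ?_
  induction s with
  | zero => rfl
  | succ s ih => simp only [enumerated, ← ih]

variable {R : ℕ × List Bool → ℕ → Prop}

theorem enumerated_mono {s t : ℕ} (hst : s ≤ t) : enumerated R s ⊆ enumerated R t := by
  induction t, hst using Nat.le_induction with
  | base => exact List.Subset.refl _
  | succ t _ ih =>
    refine List.Subset.trans ih ?_
    rw [enumerated]
    split_ifs
    · exact List.subset_cons_self _ _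
    · exact List.Subset.refl _

theorem stageElement_mem {s : ℕ} (h : Acts R s (enumerated R s)) :
    stageElement s ∈ enumerated R (s + 1) := by
  rw [enumerated, if_pos h]
  exact List.mem_cons_self

/-- Each enumerated element was enumerated at some stage devoted to it. -/
theorem exists_acts {s x : ℕ} (hx : x ∈ enumerated R s) :
    ∃ t, stageElement t = x ∧ Acts R t (enumerated R t) := by
  induction s with
  | zero => simp [enumerated] at hx
  | succ s ih =>
    rw [enumerated] at hx
    split_ifs at hx with h
    · rcases List.mem_cons.1 hx with rfl | hx
      · exact ⟨s, rfl, h⟩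
      · exact ih hx
    · exact ih hx

/-- Below any bound, the enumeration is complete from some stage on. -/
theorem exists_stage (R : ℕ × List Bool → ℕ → Prop) (N : ℕ) :
    ∃ s₀, ∀ s ≥ s₀, ∀ i < N, i ∈ enumerated R s ↔ ∃ t, i ∈ enumerated R t := by
  choose! T hT using fun i (hi : ∃ t, i ∈ enumerated R t) => hi
  refine ⟨(Finset.range N).sup T, fun s hs i hi => ⟨fun h => ⟨s, h⟩, fun h => ?_⟩⟩
  exact enumerated_mono ((Finset.le_sup (f := T) (Finset.mem_range.2 hi)).trans hs) (hT i h)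

/-- There are arbitrarily late stages handling a given element with a given list of witnesses. -/
theorem exists_stageData (c j : ℕ) (L : List ℕ) (s₀ : ℕ) :
    ∃ s ≥ s₀, (stageData s).1 = (c, j) ∧ L ⊆ (stageData s).2 := by
  have hinj : Function.Injective fun k : ℕ =>
      Encodable.encode (((c, j), k :: L) : (ℕ × ℕ) × List ℕ) :=
    Encodable.encode_injective.comp fun a b hab => by simpa using hab
  obtain ⟨k, hk⟩ := (hinj.nat_tendsto_atTop.eventually_ge_atTop s₀).exists
  refine ⟨_, hk, ?_, ?_⟩
  · rw [stageData, Denumerable.ofNat_encode]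
  · rw [stageData, Denumerable.ofNat_encode]
    exact List.subset_cons_self _ _

/-- There is an enumerable set `A` such that, whenever `R` has a witness for every initial
segment of `A` with the parameter `c`, there are sets `E j`, consisting of the elements enumerated
just before `element c j` enters `A`, with the following properties. `R` has witnesses
for the initial segments of `E j` of the lengths from `element c j + 1` to `4 * element c j`, and
those of equal length for different `j` are distinct. -/
theorem exists_set (hR : PrimrecRel R) : ∃ A : Set ℕ, REPred (fun n => n ∈ A) ∧
    ∀ c, (∀ n, 1 ≤ n → ∃ z, R (c, initialSegment A n) z) → ∃ E : ℕ → Set ℕ,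
      (∀ j n, element c j < n → n ≤ 4 * element c j → ∃ z, R (c, initialSegment (E j) n) z) ∧
      ∀ j j' n, element c j < n → element c j' < n →
        initialSegment (E j) n = initialSegment (E j') n → j = j' := by
  refine ⟨{i | ∃ s, i ∈ enumerated R s}, ?_, ?_⟩
  · have h1 : PrimrecRel fun i s => i ∈ enumerated R s :=
      primrecRel_mem.comp₂ ((primrec_enumerated hR).comp₂ Primrec₂.right) Primrec₂.left
    exact h1.rePred_exists
  intro c hc
  have hacts : ∀ j, ∃ s, (stageData s).1 = (c, j) ∧ Acts R s (enumerated R s) := by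
    intro j
    have hmem : ∃ s, element c j ∈ enumerated R s := by
      -- otherwise a late stage with sufficient witnesses would enumerate the element
      by_contra hnot
      obtain ⟨s₀, hs₀⟩ := exists_stage R (4 * element c j + 1)
      choose! z hz using hc
      obtain ⟨s, hs, hcj, hL⟩ := exists_stageData c j
        ((List.range (3 * element c j)).map fun i => z (element c j + 1 + i)) s₀
      have hel : stageElement s = element c j := by rw [stageElement, hcj]
      refine hnot ⟨s + 1, hel ▸ stageElement_mem ⟨fun h => hnot ⟨s, hel ▸ h⟩, fun i hi => ?_⟩⟩
      rw [hel] at hi ⊢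
      refine ⟨_, hL (List.mem_map_of_mem hi), ?_⟩
      have hseg : initialSegment {x | x ∈ enumerated R s} (element c j + 1 + i) =
          initialSegment {i | ∃ s, i ∈ enumerated R s} (element c j + 1 + i) := by
        rw [initialSegment_eq_iff]
        intro k hk
        rw [List.mem_range] at hi
        exact hs₀ s hs k (by omega)
      rw [hseg, hcj]
      exact hz _ (by omega)
    obtain ⟨s, hs⟩ := hmem
    obtain ⟨t, ht, hact⟩ := exists_acts hs
    obtain ⟨h1, h2⟩ := element_injective ht
    exact ⟨t, Prod.ext h1 h2, hact⟩
  choose S hS hSa using hacts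
  have hel : ∀ j, stageElement (S j) = element c j := fun j => by rw [stageElement, hS]
  refine ⟨fun j => {x | x ∈ enumerated R (S j)}, fun j n hn hn' => ?_, ?_⟩
  · obtain ⟨z, _, hz⟩ := (hSa j).2 (n - (element c j + 1))
      (by rw [List.mem_range, hel]; omega)
    rw [hel, hS, Nat.add_sub_cancel' hn] at hz
    exact ⟨z, hz⟩
  · have key : ∀ j j' n, element c j < n → S j < S j' →
        initialSegment {x | x ∈ enumerated R (S j)} n ≠
          initialSegment {x | x ∈ enumerated R (S j')} n := by
      intro j j' n hn hlt heq
      have h1 : element c j ∈ enumerated R (S j') :=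
        enumerated_mono hlt (hel j ▸ stageElement_mem (hSa j))
      have h2 : element c j ∉ enumerated R (S j) := hel j ▸ (hSa j).1
      exact h2 ((initialSegment_eq_iff.1 heq _ hn).2 h1)
    intro j j' n hn hn' heq
    rcases lt_trichotomy (S j) (S j') with h | h | h
    · exact absurd heq (key j j' n hn h)
    · have := hS j
      rw [h, hS j'] at this
      exact (Prod.ext_iff.1 this).2.symm
    · exact absurd heq.symm (key j' j n hn' h)

end CostlySet

/-! ### Summability from the complexity bound -/

/-- Having a program of length at most `h n + log n + c`, where `n` is the length of the string, is
the projection of a primitive recursive relation. -/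
theorem exists_primrecRel_program {U : List Bool →. List Bool} (hU : Partrec U) {h : ℕ → ℕ}
    (hh : Computable h) : ∃ R : ℕ × List Bool → ℕ → Prop, PrimrecRel R ∧ ∀ c σ, (∃ z, R (c, σ) z) ↔
      ∃ p, σ ∈ U p ∧ p.length ≤ h σ.length + Nat.log 2 σ.length + c := by
  have hre : REPred fun a : (ℕ × List Bool) × List Bool =>
      a.1.2 ∈ U a.2 ∧ a.2.length ≤ h a.1.2.length + Nat.log 2 a.1.2.length + a.1.1 := by
    have hlen : Computable fun a : (ℕ × List Bool) × List Bool => a.1.2.length :=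
      (Primrec.list_length.comp (Primrec.snd.comp Primrec.fst)).to_comp
    have hbound : Computable fun a : (ℕ × List Bool) × List Bool =>
        decide (a.2.length ≤ h a.1.2.length + Nat.log 2 a.1.2.length + a.1.1) :=
      Primrec.nat_le.decide.to_comp.comp (Computable.list_length.comp Computable.snd)
        (Primrec.nat_add.to_comp.comp (Primrec.nat_add.to_comp.comp (hh.comp hlen)
          (Primrec.nat_log_two.to_comp.comp hlen)) (Computable.fst.comp Computable.fst))
    have heq : Computable fun q : ((ℕ × List Bool) × List Bool) × List Bool =>
        decide (q.2 = q.1.1.2) :=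
      (Primrec.eq.decide.comp Primrec.snd
        (Primrec.snd.comp (Primrec.fst.comp Primrec.fst))).to_comp
    have htest : Computable fun q : ((ℕ × List Bool) × List Bool) × List Bool =>
        cond (decide (q.2 = q.1.1.2)) (cond (decide (q.1.2.length ≤
          h q.1.1.2.length + Nat.log 2 q.1.1.2.length + q.1.1.1)) (some ()) none) none :=
      Computable.cond heq (Computable.cond (hbound.comp Computable.fst) (Computable.const _)
        (Computable.const _)) (Computable.const _)
    refine (Partrec.bind (hU.comp Computable.snd)
      (Computable.ofOption htest).to₂).dom_re.of_eq fun a => ?_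
    rw [Part.dom_iff_mem]
    simp only [Part.mem_bind_iff]
    constructor
    · rintro ⟨u, y, hy, hu⟩
      by_cases h1 : y = a.1.2
      · by_cases h2 : a.2.length ≤ h a.1.2.length + Nat.log 2 a.1.2.length + a.1.1
        · exact ⟨h1 ▸ hy, h2⟩
        · simp [h1, h2] at hu
      · simp [h1] at hu
    · rintro ⟨h1, h2⟩
      exact ⟨(), a.1.2, h1, by simp [h2]⟩
  obtain ⟨R, hR, hRp⟩ := hre.exists_primrecRel
  -- a witness encodes a program together with a number of steps
  let w : ℕ → List Bool × ℕ := fun z => (Encodable.decode z).getD ([], 0)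
  have hw : Primrec w := Primrec.option_getD.comp Primrec.decode (Primrec.const _)
  refine ⟨fun a z => R (a, (w z).1) (w z).2, ?_, fun c σ => ?_⟩
  · exact hR.comp (Primrec.fst.pair (Primrec.fst.comp (hw.comp Primrec.snd)))
      (Primrec.snd.comp (hw.comp Primrec.snd))
  · constructor
    · rintro ⟨z, hz⟩
      exact ⟨(w z).1, (hRp ((c, σ), (w z).1)).2 ⟨_, hz⟩⟩
    · rintro ⟨p, hp⟩
      obtain ⟨t, ht⟩ := (hRp ((c, σ), p)).1 hp
      refine ⟨Encodable.encode (p, t), ?_⟩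
      simpa only [w, Encodable.encodek, Option.getD_some] using ht

/-- If for every `j` and every length `n` from `element c j + 1` to `4 * element c j` some string of
length `n` has a program of length at most `h n + log n + c`, and for fixed `n` these strings are
pairwise distinct, then `∑ 2 ^ (-h n)` converges: for each large `n` there are at least
`n / 2 ^ (c + 3)` strings, so that they contribute at least `2 ^ (-h n - 2 * c - 3)` to the Kraft
sum. -/
theorem summable_of_distinct_strings {U : List Bool →. List Bool} (hU : IsPrefixFreeMachine U)
    {h : ℕ → ℕ} (c : ℕ) {E : ℕ → Set ℕ}
    (hprog : ∀ j n, CostlySet.element c j < n → n ≤ 4 * CostlySet.element c j →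
      ∃ p, initialSegment (E j) n ∈ U p ∧ p.length ≤ h n + Nat.log 2 n + c)
    (hinj : ∀ j j' n, CostlySet.element c j < n → CostlySet.element c j' < n →
      initialSegment (E j) n = initialSegment (E j') n → j = j') :
    Summable fun n => (2 ^ h n : ℝ)⁻¹ := by
  let J : ℕ → Finset ℕ := fun n => Finset.Ico (n / 2 ^ (c + 1) / 2) (n / 2 ^ (c + 1))
  have hJ : ∀ n, ∀ j ∈ J n, CostlySet.element c j < n ∧ n ≤ 4 * CostlySet.element c j := by
    intro n j hj
    obtain ⟨h1, h2⟩ := Finset.mem_Ico.1 hj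
    have hpos : 0 < 2 ^ c := by positivity
    have h3 : n < 2 ^ (c + 1) * (n / 2 ^ (c + 1) + 1) :=
      Nat.lt_mul_div_succ n (by positivity)
    have h4 : 2 ^ (c + 1) * (n / 2 ^ (c + 1)) ≤ n := Nat.mul_div_le _ _
    generalize n / 2 ^ (c + 1) = q at h1 h2 h3 h4
    rw [CostlySet.element]
    rw [pow_succ] at h3 h4
    constructor
    · nlinarith
    · have h5 : q + 1 ≤ 2 * j + 2 := by omega
      nlinarith
  have hcard : ∀ n, 2 ^ (c + 1) ≤ n →
      (2 ^ (2 * c + 3) : ℝ)⁻¹ ≤ (J n).card * (2 ^ (Nat.log 2 n + c) : ℝ)⁻¹ := by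
    intro n hn
    have h1 : 2 ^ Nat.log 2 n ≤ n := Nat.pow_log_le_self 2 ((Nat.two_pow_pos _).trans_le hn).ne'
    have h3 : n < 2 ^ (c + 1) * (n / 2 ^ (c + 1) + 1) :=
      Nat.lt_mul_div_succ n (by positivity)
    have h4 : 1 ≤ n / 2 ^ (c + 1) := (Nat.one_le_div_iff (by positivity)).2 hn
    have h5 : 2 ^ (Nat.log 2 n + c) ≤ (J n).card * 2 ^ (2 * c + 3) := by
      simp only [J, Nat.card_Ico]
      generalize n / 2 ^ (c + 1) = q at h3 h4
      have h6 : q + 1 ≤ 4 * (q - q / 2) := by omega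
      calc 2 ^ (Nat.log 2 n + c) = 2 ^ Nat.log 2 n * 2 ^ c := pow_add _ _ _
        _ ≤ (2 ^ (c + 1) * (q + 1)) * 2 ^ c := by gcongr; omega
        _ ≤ (2 ^ (c + 1) * (4 * (q - q / 2))) * 2 ^ c := by gcongr
        _ = (q - q / 2) * 2 ^ (2 * c + 3) := by ring
    have h7 : (2 ^ (Nat.log 2 n + c) : ℝ) ≤ (J n).card * 2 ^ (2 * c + 3) := by exact_mod_cast h5
    rw [← div_eq_mul_inv, le_div_iff₀ (by positivity), inv_mul_le_iff₀ (by positivity)]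
    linarith
  refine summable_of_sum_range_le (c := ∑ n ∈ Finset.range (2 ^ (c + 1)), (2 ^ h n : ℝ)⁻¹ +
    2 ^ (2 * c + 3)) (fun n => by positivity) fun N => ?_
  have hkraft : ∑ a ∈ (Finset.Ico (2 ^ (c + 1)) N).sigma J,
      (2 ^ (h a.1 + Nat.log 2 a.1 + c) : ℝ)⁻¹ ≤ 1 := by
    refine hU.sum_le_one _ (σ := fun a : (_ : ℕ) × ℕ => initialSegment (E a.2) a.1)
      (l := fun a => h a.1 + Nat.log 2 a.1 + c) ?_ ?_
    · rintro ⟨n, j⟩ hj ⟨n', j'⟩ hj' heq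
      obtain rfl : n = n' := by simpa using congrArg List.length heq
      have h1 := hJ n j (Finset.mem_sigma.1 hj).2
      have h2 := hJ n j' (Finset.mem_sigma.1 hj').2
      obtain rfl := hinj j j' n h1.1 h2.1 heq
      rfl
    · rintro ⟨n, j⟩ hj
      have h1 := hJ n j (Finset.mem_sigma.1 hj).2
      exact hprog j n h1.1 h1.2
  have htail : ∑ n ∈ Finset.Ico (2 ^ (c + 1)) N, (2 ^ h n : ℝ)⁻¹ ≤ 2 ^ (2 * c + 3) := by
    have h1 : ∑ n ∈ Finset.Ico (2 ^ (c + 1)) N, (2 ^ h n : ℝ)⁻¹ * (2 ^ (2 * c + 3) : ℝ)⁻¹ ≤ 1 := by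
      refine le_trans (Finset.sum_le_sum fun n hn => ?_)
        ((Finset.sum_sigma _ _ _).symm.trans_le hkraft)
      dsimp only
      rw [Finset.sum_const, nsmul_eq_mul, add_assoc, pow_add 2 (h n), mul_inv, mul_left_comm]
      gcongr
      exact hcard n (Finset.mem_Ico.1 hn).1
    rw [← Finset.sum_mul, ← div_eq_mul_inv, div_le_one (by positivity)] at h1
    exact h1
  calc ∑ n ∈ Finset.range N, (2 ^ h n : ℝ)⁻¹
      ≤ ∑ n ∈ Finset.range (2 ^ (c + 1)) ∪ Finset.Ico (2 ^ (c + 1)) N, (2 ^ h n : ℝ)⁻¹ := by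
        refine Finset.sum_le_sum_of_subset_of_nonneg (fun n hn => ?_) fun n _ _ => by positivity
        rw [Finset.mem_range] at hn
        rw [Finset.mem_union, Finset.mem_range, Finset.mem_Ico]
        omega
    _ ≤ ∑ n ∈ Finset.range (2 ^ (c + 1)), (2 ^ h n : ℝ)⁻¹ +
        ∑ n ∈ Finset.Ico (2 ^ (c + 1)) N, (2 ^ h n : ℝ)⁻¹ := by
        rw [← Finset.sum_union_inter]
        exact le_add_of_nonneg_right (Finset.sum_nonneg fun n _ => by positivity)
    _ ≤ _ := by gcongr

/-- The lower bound: if all enumerable sets obey the complexity bound, with `log` rounded down, then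
`∑ 2 ^ (-h n)` converges. -/
theorem summable_of_complexity_le {U : List Bool →. List Bool}
    (hU : IsUniversalPrefixFreeMachine U) {h : ℕ → ℕ} (hh : Computable h)
    (hA : ∀ A : Set ℕ, REPred (fun n => n ∈ A) → ∃ c : ℕ, ∀ n, 1 ≤ n →
      prefixFreeComplexity U (initialSegment A n) ≤ h n + Nat.log 2 n + c) :
    Summable fun n => (2 ^ h n : ℝ)⁻¹ := by
  obtain ⟨R, hR, hRp⟩ := exists_primrecRel_program hU.partrec hh
  obtain ⟨A, hAre, hAR⟩ := CostlySet.exists_set hR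
  obtain ⟨c, hc⟩ := hA A hAre
  obtain ⟨E, hE, hinj⟩ := hAR c fun n hn => by
    obtain ⟨p₀, hp₀⟩ := hU.exists_program (initialSegment A n)
    obtain ⟨p, hp, hpl⟩ := Nat.sInf_mem
      (s := {l | ∃ p, initialSegment A n ∈ U p ∧ p.length = l}) ⟨_, p₀, hp₀, rfl⟩
    rw [hRp, length_initialSegment]
    exact ⟨p, hp, hpl.trans_le (hc n hn)⟩
  refine summable_of_distinct_strings hU.toIsPrefixFreeMachine c (fun j n h1 h2 => ?_) hinj
  simpa using (hRp _ _).1 (hE j n h1 h2)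

theorem mainTheorem6 (U : List Bool →. List Bool) (hU : IsUniversalPrefixFreeMachine U)
    (h : ℕ → ℕ) (h_comp : Computable h) (h_mono : Monotone h) :
    (∀ A : Set ℕ, REPred (fun n : ℕ => n ∈ A) →
        ∃ c : ℝ, ∀ n : ℕ, 1 ≤ n →
          (prefixFreeComplexity U (initialSegment A n) : ℝ) ≤ h n + Real.logb 2 n + c) ↔
      Summable (fun n : ℕ => (2 : ℝ) ^ (-(h n : ℝ))) := by
  have hpow : (fun n : ℕ => (2 : ℝ) ^ (-(h n : ℝ))) = fun n => (2 ^ h n : ℝ)⁻¹ := by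
    funext n
    rw [Real.rpow_neg zero_le_two, Real.rpow_natCast]
  rw [hpow]
  constructor
  · intro hA
    refine summable_of_complexity_le hU h_comp fun A hre => ?_
    obtain ⟨c, hc⟩ := hA A hre
    refine ⟨⌈c⌉₊ + 1, fun n hn => ?_⟩
    have h1 : Real.logb 2 n < Nat.log 2 n + 1 := by
      have := Nat.lt_floor_add_one (Real.logb 2 n)
      rwa [← Nat.cast_ofNat (n := 2), Real.natFloor_logb_natCast] at this
    have h2 : (prefixFreeComplexity U (initialSegment A n) : ℝ) ≤
        h n + Nat.log 2 n + (⌈c⌉₊ + 1) := by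
      linarith [hc n hn, Nat.le_ceil c]
    exact_mod_cast h2
  · intro hs A hre
    obtain ⟨c, hc⟩ := complexity_le_of_summable hU h_comp h_mono hs hre
    refine ⟨c, fun n _ => ?_⟩
    have h1 : (Nat.log 2 n : ℝ) ≤ Real.logb 2 n := by exact_mod_cast Real.natLog_le_logb n 2
    have h2 : (prefixFreeComplexity U (initialSegment A n) : ℝ) ≤ h n + Nat.log 2 n + c := by
      exact_mod_cast hc n
    linarith
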